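/- \textbf{Theorem.} Let $\lambda>0$, $n\ge 0$ and $\mu_1,\dots,\mu_n>0$. A source submits updates $1,2,\dots$ at the points $U_1<U_2<\cdots$ of a Poisson process of rate $\lambda$ started at time $0$ (the interarrival times are i.i.d. exponential of rate $\lambda$). The updates pass through nodes $1,\dots,n$ in series to a monitor. Each node is a preemptive last-come-first-served server without queue ($\cdot$/M/1/1): an update that arrives at node $k$ enters service at once, any update that was in service there is preempted and discarded, and an update that completes its service at node $k$ moves at once to node $k+1$ (to the monitor if $k=n$). The service times at node $k$ are exponential of rate $\mu_k$, and all interarrival and service times are independent. The network is empty at time $0$. For $t\ge 0$, the age at a given point of the network (the input of a node, or the monitor) is $t-U(t)$, where $U(t)$ is the largest submission time $U_i$ of an update that has arrived at that point by time $t$; as long as no update has arrived there, $U(t)=-a_0$ for a fixed initial age $a_0\ge 0$. The average age at that point is the limit of the expected age as $t\to\infty$. Then: (1) at every time $t\ge 0$ the age at the monitor has finite expectation, the average age at the monitor exists, and $$\Delta(\lambda,\mu_1,\dots,\mu_n)=\frac1\lambda+\sum_{i=1}^n\frac1{\mu_i};$$ (2) for each $k\in\{1,\dots,n\}$, at every time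 $t\ge 0$ the age at the input of node $k$ has finite expectation, and the average age there exists and equals $$\frac1\lambda+\sum_{i=1}^{k-1}\frac1{\mu_i};$$ (3) the average age at the monitor does not depend on the order of the servers: for every permutation $\sigma$ of $\{1,\dots,n\}$, if the servers (with their service times) are arranged in the order $\sigma(1),\dots,\sigma(n)$, then the age at the monitor again has finite expectation at every time $t\ge0$, and its average exists and equals $\frac1\lambda+\sum_{i=1}^n\frac1{\mu_i}$. -/

import Mathlib

open MeasureTheory ProbabilityTheory Filter Topology

noncomputable section

namespace LineNetwork

variable {n : ℕ}

/-- The submission times `U 0 < U 1 < ⋯` of the updates, given the interarrival times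
`X 0, X 1, …`: the first update is submitted at time `X 0`, and `X (i + 1)` is the time
between update `i` and update `i + 1`. -/
def submissionTime (X : ℕ → ℝ) (i : ℕ) : ℝ :=
  ∑ j ∈ Finset.range (i + 1), X j

open Classical in
/-- A `·/M/1/1` preemptive server. Update `i` arrives at time `a i` (`⊤` if it never arrives),
goes into service at once and needs the service time `s i`. If another update arrives before
that service is completed, then update `i` is preempted and discarded, and its departure time
is `⊤`; otherwise it departs at time `a i + s i`. -/
def preemptiveServer (s : ℕ → ℝ) (a : ℕ → EReal) (i : ℕ) : EReal :=
  if ∃ j, a i < a j ∧ a j < a i + (s i : EReal) then ⊤ else a i + (s i : EReal)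

/-- `arrivalTime X S k i` is the time at which update `i` arrives at stage `k` of the line
network (`⊤` if it has been discarded before). Stage `k.castSucc` is the input of node
`k : Fin n`, stage `k.succ` is the output of node `k`, and stage `Fin.last n` is the monitor.
`X` are the interarrival times at the source and `S k i` is the service time of update `i`
at node `k`. -/
def arrivalTime (X : ℕ → ℝ) (S : Fin n → ℕ → ℝ) (k : Fin (n + 1)) : ℕ → EReal :=
  Fin.induction (motive := fun _ => ℕ → EReal)
    (fun i => (submissionTime X i : EReal))
    (fun k a => preemptiveServer (S k) a) k

theorem arrivalTime_zero (X : ℕ → ℝ) (S : Fin n → ℕ → ℝ) (i : ℕ) :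
    arrivalTime X S 0 i = (submissionTime X i : EReal) := rfl

theorem arrivalTime_succ (X : ℕ → ℝ) (S : Fin n → ℕ → ℝ) (k : Fin n) :
    arrivalTime X S k.succ = preemptiveServer (S k) (arrivalTime X S k.castSucc) := rfl

/-- The time stamp at time `t` of the most recent update that stage `k` has received, that is
the largest submission time of an update that has arrived there by time `t`. At time `0` the
network is empty and the stage knows a status of age `a₀`, with time stamp `-a₀`. -/
def timeStamp (X : ℕ → ℝ) (S : Fin n → ℕ → ℝ) (a₀ : ℝ) (k : Fin (n + 1)) (t : ℝ) : ℝ :=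
  sSup (insert (-a₀) {u | ∃ i, arrivalTime X S k i ≤ (t : EReal) ∧ u = submissionTime X i})

/-- The age of information at stage `k` at time `t`. -/
def age (X : ℕ → ℝ) (S : Fin n → ℕ → ℝ) (a₀ : ℝ) (k : Fin (n + 1)) (t : ℝ) : ℝ :=
  t - timeStamp X S a₀ k t

/-- The random data of a line network of `n` memoryless servers. Updates are submitted as a
Poisson process of rate `lam` (the interarrival times `X i` are independent and exponential of
rate `lam`), the service times `S k i` at node `k` are exponential of rate `mu k`, and all
interarrival times and service times are independent. -/
structure IsLineNetwork {Ω : Type*} [MeasurableSpace Ω] (P : Measure Ω) (lam : ℝ)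
    (mu : Fin n → ℝ) (X : ℕ → Ω → ℝ) (S : Fin n → ℕ → Ω → ℝ) : Prop where
  interarrival : ∀ i, HasLaw (X i) (expMeasure lam) P
  service : ∀ k i, HasLaw (S k i) (expMeasure (mu k)) P
  indep : iIndepFun (Sum.elim X fun p : Fin n × ℕ => S p.1 p.2) P

/-- The age process at stage `k` has average age `Δ`: the age has finite expectation at every
time `t ≥ 0`, and this expectation tends to `Δ` as `t → ∞`. -/
def HasAverageAge {Ω : Type*} [MeasurableSpace Ω] (P : Measure Ω)
    (X : ℕ → Ω → ℝ) (S : Fin n → ℕ → Ω → ℝ) (a₀ : ℝ) (k : Fin (n + 1)) (Δ : ℝ) : Prop :=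
  (∀ t : ℝ, 0 ≤ t → Integrable (fun ω => age (X · ω) (fun j i => S j i ω) a₀ k t) P) ∧
    Tendsto (fun t : ℝ => ∫ ω, age (X · ω) (fun j i => S j i ω) a₀ k t ∂P) atTop (𝓝 Δ)

end LineNetwork

end

/-!
The age at a stage exceeds `x` at time `t` exactly when no update submitted at time `u = t - x` or
later has arrived there by time `t`. Call such updates fresh, and follow the first time at which a
stage receives a fresh update.

At the source this time is `u` plus an exponential time of rate `lam`, because the Poisson process
has no memory (`measure_forall_fresh_lt_submissionTime`). Suppose that a fresh update has reached
node `k`. From then on the node always serves a fresh update until it delivers one: updates travel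
in order, so a fresh update is only ever preempted by a fresher one, and a preemption merely
restarts an exponential service. Hence the first fresh departure comes an independent exponential
time of rate `mu k` after the first fresh arrival (`measure_forall_lt_preemptiveServer`, where the
successive gaps between arrivals telescope; `measure_fresh_preemptiveServer` averages over the
arrivals). By induction along the line, the delay after which stage `k` receives a fresh update is
a sum of independent exponential times, whatever `u ≥ 0` (`exists_isRegularStage`).

So the age at time `t` has the law of this delay, truncated at `t` where the initial status takes
over (`map_age_eq`). As `t → ∞`, dominated convergence gives the mean of the delay, which is
`1 / lam` plus the sum of the `1 / mu i` over the nodes passed. Permuting the nodes gives another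
line network, with the same sum.
-/

namespace LineNetwork

variable {n : ℕ} {Ω : Type*} [MeasurableSpace Ω] {P : Measure Ω}

/-! ### Exponential laws and delay laws -/

theorem expMeasure_Ioi {r : ℝ} (hr : 0 < r) (x : ℝ) :
    expMeasure r (Set.Ioi x) = ENNReal.ofReal (Real.exp (-(r * max x 0))) := by
  have := isProbabilityMeasure_expMeasure hr
  have h1 : expMeasure r (Set.Iic x) =
      ENNReal.ofReal (if 0 ≤ x then 1 - Real.exp (-(r * x)) else 0) := by
    rw [← cdf_expMeasure_eq hr, ofReal_cdf]
  rw [← Set.compl_Iic, prob_compl_eq_one_sub measurableSet_Iic, h1]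
  split_ifs with h
  · rw [← ENNReal.ofReal_one, ← ENNReal.ofReal_sub, max_eq_left h]
    · congr 1; ring
    · have : Real.exp (-(r * x)) ≤ 1 := Real.exp_le_one_iff.2 (by nlinarith)
      linarith
  · rw [max_eq_right (by linarith)]; simp

theorem nullSingletonClass_expMeasure (r : ℝ) : NullSingletonClass (expMeasure r) := by
  unfold expMeasure gammaMeasure
  infer_instance

theorem expMeasure_Ici {r : ℝ} (hr : 0 < r) (x : ℝ) :
    expMeasure r (Set.Ici x) = ENNReal.ofReal (Real.exp (-(r * max x 0))) := by
  have := nullSingletonClass_expMeasure r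
  rw [← expMeasure_Ioi hr, measure_congr Ioi_ae_eq_Ici]

theorem ae_pos_expMeasure {r : ℝ} (hr : 0 < r) : ∀ᵐ x ∂expMeasure r, 0 < x := by
  have := isProbabilityMeasure_expMeasure hr
  have h : expMeasure r (Set.Ioi 0) = 1 := by simp [expMeasure_Ioi hr]
  exact (prob_compl_eq_zero_iff measurableSet_Ioi).2 h

theorem lintegral_id_expMeasure {r : ℝ} (hr : 0 < r) :
    ∫⁻ x, ENNReal.ofReal x ∂expMeasure r = ENNReal.ofReal (1 / r) := by
  rw [lintegral_eq_lintegral_meas_lt (expMeasure r)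
    ((ae_pos_expMeasure hr).mono fun x hx => hx.le) aemeasurable_id']
  have h1 : ∫⁻ t in Set.Ioi (0 : ℝ), expMeasure r {a | t < a} =
      ∫⁻ t in Set.Ioi (0 : ℝ), ENNReal.ofReal (Real.exp (-r * t)) := by
    refine setLIntegral_congr_fun measurableSet_Ioi fun t ht => ?_
    change expMeasure r (Set.Ioi t) = _
    rw [expMeasure_Ioi hr, max_eq_left (le_of_lt ht), neg_mul]
  rw [h1, ← ofReal_integral_eq_lintegral_ofReal]
  · rw [integral_exp_mul_Ioi (by linarith)]; simp
  · exact integrableOn_exp_mul_Ioi (by linarith) 0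
  · exact Eventually.of_forall fun _ => (Real.exp_pos _).le

theorem integrable_id_expMeasure {r : ℝ} (hr : 0 < r) : Integrable (fun x => x) (expMeasure r) := by
  refine ⟨aestronglyMeasurable_id, ?_⟩
  rw [hasFiniteIntegral_iff_ofReal ((ae_pos_expMeasure hr).mono fun x hx => hx.le),
    lintegral_id_expMeasure hr]
  exact ENNReal.ofReal_lt_top

theorem integral_id_expMeasure {r : ℝ} (hr : 0 < r) : ∫ x, x ∂expMeasure r = 1 / r := by
  rw [integral_eq_lintegral_of_nonneg_ae ((ae_pos_expMeasure hr).mono fun x hx => hx.le)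
    aestronglyMeasurable_id, lintegral_id_expMeasure hr, ENNReal.toReal_ofReal (by positivity)]

/-- What is used of the law of the time after which a stage first receives an update submitted
after a given instant: it is a probability measure with finite mean `m`. -/
structure IsDelayLaw (ν : Measure ℝ) (m : ℝ) : Prop where
  isProbabilityMeasure : IsProbabilityMeasure ν
  integrable : Integrable (fun x => x) ν
  integral_eq : ∫ x, x ∂ν = m

theorem isDelayLaw_expMeasure {r : ℝ} (hr : 0 < r) : IsDelayLaw (expMeasure r) (1 / r) :=
  ⟨isProbabilityMeasure_expMeasure hr, integrable_id_expMeasure hr,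
    integral_id_expMeasure hr⟩

theorem IsDelayLaw.conv {ν ρ : Measure ℝ} {a b : ℝ} (hν : IsDelayLaw ν a) (hρ : IsDelayLaw ρ b) :
    IsDelayLaw (Measure.conv ν ρ) (a + b) := by
  have := hν.isProbabilityMeasure
  have := hρ.isProbabilityMeasure
  have hm : AEMeasurable (fun x : ℝ × ℝ => x.1 + x.2) (ν.prod ρ) := by fun_prop
  have h1 : Integrable (fun x : ℝ × ℝ => x.1) (ν.prod ρ) := hν.integrable.comp_fst ρ
  have h2 : Integrable (fun x : ℝ × ℝ => x.2) (ν.prod ρ) := hρ.integrable.comp_snd ν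
  refine ⟨inferInstance, ?_, ?_⟩
  · rw [Measure.conv, integrable_map_measure (by fun_prop) hm]
    exact h1.add h2
  · rw [Measure.conv, integral_map hm (by fun_prop), integral_add h1 h2,
      integral_fun_fst (fun x : ℝ => x), integral_fun_snd (fun x : ℝ => x), hν.integral_eq,
      hρ.integral_eq]
    simp

/-- The tail of a sum of two independent variables, conditioned on the second summand. -/
theorem conv_Ioi {ν ρ : Measure ℝ} [SFinite ν] [SFinite ρ] (x : ℝ) :
    Measure.conv ν ρ (Set.Ioi x) = ∫⁻ e, ν (Set.Ioi (x - e)) ∂ρ := by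
  rw [Measure.conv, Measure.map_apply (by fun_prop) measurableSet_Ioi,
    Measure.prod_apply_symm (by measurability)]
  refine lintegral_congr fun e => congrArg _ ?_
  ext y; simp [sub_lt_iff_lt_add]

/-! ### A preemptive server with fixed arrivals -/

/-- The memoryless property of the server. Updates `i ∈ I` arrive at the times `b i ≤ t`, in the
order of their indices. The left side is the probability that none of them has been delivered by
time `t`: update `i` is preempted by the next arrival or is still in service. The successive gaps
telescope, so this is the probability that one single exponential service, begun at the first of
the arrivals, lasts beyond time `t`. Written as on the right, no first arrival has to be
named, and `I = ∅` needs no exception. -/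
theorem prod_expMeasure_survive {r : ℝ} (hr : 0 < r) (b : ℕ → ℝ) (I : Finset ℕ) :
    StrictMonoOn b I → ∀ t, (∀ i ∈ I, b i ≤ t) →
    ∏ i ∈ I, expMeasure r {s | (∃ j ∈ I, b i < b j ∧ b j < b i + s) ∨ t < b i + s} =
      expMeasure r {e | ∀ i ∈ I, t - e < b i} := by
  have := isProbabilityMeasure_expMeasure hr
  induction I using Finset.induction_on_max with
  | empty => intros; simp
  | insert m I hm ih =>
    intro hb t ht
    have hmI : m ∉ I := fun h => lt_irrefl _ (hm m h)
    have hbm : ∀ i ∈ I, b i < b m := fun i hi => hb (by simp [hi]) (by simp) (hm i hi)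
    have hmt : b m ≤ t := ht m (by simp)
    rw [Finset.prod_insert hmI]
    -- The latest update `m` is delivered unless its service lasts beyond `t`.
    have h1 : {s | (∃ j ∈ insert m I, b m < b j ∧ b j < b m + s) ∨ t < b m + s} =
        Set.Ioi (t - b m) := by
      ext s
      simp only [Set.mem_ofPred_eq, Set.mem_Ioi, sub_lt_iff_lt_add']
      constructor
      · rintro (⟨j, hj, hj1, hj2⟩ | h)
        · rcases Finset.mem_insert.1 hj with rfl | hj
          · exact absurd hj1 (lt_irrefl _)
          · exact absurd hj1 (hbm j hj).le.not_gt
        · exact h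
      · exact Or.inr
    -- For the earlier updates the arrival of `m` plays the role of the horizon `t`.
    have h2 : ∀ i ∈ I, {s | (∃ j ∈ insert m I, b i < b j ∧ b j < b i + s) ∨ t < b i + s} =
        {s | (∃ j ∈ I, b i < b j ∧ b j < b i + s) ∨ b m < b i + s} := by
      intro i hi
      ext s
      simp only [Set.mem_ofPred_eq]
      constructor
      · rintro (⟨j, hj, hj1, hj2⟩ | h)
        · rcases Finset.mem_insert.1 hj with rfl | hj
          · exact Or.inr hj2
          · exact Or.inl ⟨j, hj, hj1, hj2⟩
        · exact Or.inr (hmt.trans_lt h)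
      · rintro (⟨j, hj, hj1, hj2⟩ | h)
        · exact Or.inl ⟨j, Finset.mem_insert_of_mem hj, hj1, hj2⟩
        · exact Or.inl ⟨m, Finset.mem_insert_self _ _, hbm i hi, h⟩
    rw [h1, Finset.prod_congr rfl fun i hi => congrArg _ (h2 i hi),
      ih (hb.mono (by simp)) (b m) fun i hi => (hbm i hi).le]
    rcases I.eq_empty_or_nonempty with rfl | hI
    · simp only [Finset.notMem_empty, false_imp_iff, implies_true, Set.ofPred_true, measure_univ,
        mul_one, insert_empty_eq, Finset.mem_singleton, forall_eq]
      congr 1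
      ext e; simp only [Set.mem_Ioi, Set.mem_ofPred_eq]; constructor <;> intro <;> linarith
    · obtain ⟨k, hk, hkmin⟩ := I.exists_min_image b hI
      have h3 : {e | ∀ i ∈ I, b m - e < b i} = Set.Ioi (b m - b k) := by
        ext e
        simp only [Set.mem_Ioi, Set.mem_ofPred_eq]
        exact ⟨fun h => by linarith [h k hk], fun h i hi => by linarith [hkmin i hi]⟩
      have h4 : {e | ∀ i ∈ insert m I, t - e < b i} = Set.Ioi (t - b k) := by
        ext e
        simp only [Set.mem_Ioi, Set.mem_ofPred_eq]
        refine ⟨fun h => by linarith [h k (by simp [hk])], fun h i hi => ?_⟩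
        rcases Finset.mem_insert.1 hi with rfl | hi
        · linarith [hbm k hk]
        · linarith [hkmin i hi]
      rw [h3, h4, expMeasure_Ioi hr, expMeasure_Ioi hr, expMeasure_Ioi hr,
        ← ENNReal.ofReal_mul (Real.exp_pos _).le, ← Real.exp_add,
        max_eq_left (by linarith), max_eq_left (by linarith [hbm k hk]),
        max_eq_left (by linarith [hbm k hk])]
      congr 2; ring

/-- The arrival times `a` at a stage are compatible with the submission times `U`: no update arrives
before it is submitted, and an update that arrives at all does so strictly before every later
update (later updates that have been discarded have arrival time `⊤`). -/
structure IsInOrder (U : ℕ → ℝ) (a : ℕ → EReal) : Prop where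
  le : ∀ i, (U i : EReal) ≤ a i
  lt : ∀ i j, i < j → a i ≠ ⊤ → a i < a j

theorem IsInOrder.coe_toReal {U : ℕ → ℝ} {a : ℕ → EReal} (h : IsInOrder U a) {i : ℕ}
    (hi : a i ≠ ⊤) : ((a i).toReal : EReal) = a i :=
  EReal.coe_toReal hi (((EReal.bot_lt_coe _).trans_le (h.le i)).ne')

theorem IsInOrder.preemptiveServer {U : ℕ → ℝ} {a : ℕ → EReal} (h : IsInOrder U a)
    {s : ℕ → ℝ} (hs : ∀ i, 0 < s i) : IsInOrder U (preemptiveServer s a) where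
  le i := by
    unfold LineNetwork.preemptiveServer
    split_ifs
    · exact le_top
    · calc (U i : EReal) ≤ a i + 0 := by simpa using h.le i
        _ ≤ a i + s i := by gcongr; exact_mod_cast (hs i).le
  lt i j hij hi := by
    unfold LineNetwork.preemptiveServer at hi ⊢
    by_cases hc : ∃ j, a i < a j ∧ a j < a i + (s i : EReal)
    · simp [hc] at hi
    rw [if_neg hc] at hi ⊢
    push Not at hc
    have hai : a i ≠ ⊤ := fun h' => hi (by rw [h']; rfl)
    split_ifs with hcj
    · exact hi.lt_top
    · by_cases haj : a j = ⊤
      · rw [haj, EReal.top_add_coe]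
        exact hi.lt_top
      · refine (hc j (h.lt i j hij hai)).trans_lt ?_
        rw [← h.coe_toReal haj, ← EReal.coe_add, EReal.coe_lt_coe_iff]
        linarith [hs j]

/-- For a fixed sequence of arrivals at a server, the time at which the first *fresh* update (one
submitted at time `u` or later) departs is distributed as the time at which the first fresh update
arrives, delayed by one independent exponential service time. Both sides are the probability that
this happens after time `t`. -/
theorem measure_forall_lt_preemptiveServer {r : ℝ} (hr : 0 < r) {Y : ℕ → Ω → ℝ}
    (hY : ∀ i, HasLaw (Y i) (expMeasure r) P)
    (hind : iIndepFun Y P) {U : ℕ → ℝ} {a : ℕ → EReal} (hU : Monotone U)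
    (hUtop : Tendsto U atTop atTop) (ha : IsInOrder U a) (u t : ℝ) :
    P {ω | ∀ i, u ≤ U i → (t : EReal) < preemptiveServer (Y · ω) a i} =
      expMeasure r {e | ∀ i, u ≤ U i → ((t - e : ℝ) : EReal) < a i} := by
  classical
  obtain ⟨M, hM⟩ := (hUtop.eventually_gt_atTop t).exists_forall_of_atTop
  -- The fresh updates that have arrived by time `t`; since `U i → ∞`, there are finitely many.
  set I : Finset ℕ := {i ∈ Finset.range M | u ≤ U i ∧ a i ≤ t} with hI
  set b : ℕ → ℝ := fun i => (a i).toReal with hb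
  have hmem : ∀ i, i ∈ I ↔ u ≤ U i ∧ a i ≤ t := by
    intro i
    simp only [hI, Finset.mem_filter, Finset.mem_range, and_iff_right_iff_imp]
    rintro ⟨-, h⟩
    by_contra hi
    have h1 : (U i : EReal) ≤ t := (ha.le i).trans h
    exact (EReal.coe_le_coe_iff.1 h1).not_gt (hM i (not_lt.1 hi))
  have hcoe : ∀ i ∈ I, a i = b i := fun i hi =>
    (ha.coe_toReal (((hmem i).1 hi).2.trans_lt (EReal.coe_lt_top t)).ne).symm
  have hbmono : StrictMonoOn b I := by
    intro i hi j hj hij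
    have := ha.lt i j hij (by rw [hcoe i hi]; exact EReal.coe_ne_top _)
    rwa [hcoe i hi, hcoe j hj, EReal.coe_lt_coe_iff] at this
  have hbt : ∀ i ∈ I, b i ≤ t := fun i hi => by
    have := ((hmem i).1 hi).2
    rwa [hcoe i hi, EReal.coe_le_coe_iff] at this
  -- The service times of update `i` for which it has not been delivered by time `t`.
  set B : ℕ → Set ℝ := fun i => {s | (∃ j ∈ I, b i < b j ∧ b j < b i + s) ∨ t < b i + s} with hB
  have hBm : ∀ i, MeasurableSet (B i) := by
    intro i
    have : B i = (⋃ j ∈ I, {s | b i < b j ∧ b j < b i + s}) ∪ {s | t < b i + s} := by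
      ext s; simp [hB, and_left_comm]
    rw [this]
    refine (Finset.measurableSet_biUnion _ fun j _ => ?_).union
      (measurableSet_lt (by fun_prop) (by fun_prop))
    exact (MeasurableSet.const (b i < b j)).inter
      (measurableSet_lt measurable_const (measurable_const.add measurable_id))
  have hpos : ∀ᵐ ω ∂P, ∀ i, 0 < Y i ω := by
    rw [ae_all_iff]
    intro i
    exact ((hY i).ae_iff (p := fun x => 0 < x) (measurableSet_Ioi.mem)).2 (ae_pos_expMeasure hr)
  have hL : P {ω | ∀ i, u ≤ U i → (t : EReal) < preemptiveServer (Y · ω) a i} =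
      P (⋂ i ∈ I, Y i ⁻¹' B i) := by
    refine measure_congr ?_
    filter_upwards [hpos] with ω hω
    refine propext ?_
    change (∀ i, u ≤ U i → (t : EReal) < preemptiveServer (Y · ω) a i) ↔ ω ∈ ⋂ i ∈ I, Y i ⁻¹' B i
    simp only [Set.mem_iInter, Set.mem_preimage]
    have key : ∀ i ∈ I, ((t : EReal) < preemptiveServer (Y · ω) a i ↔ Y i ω ∈ B i) := by
      intro i hi
      have hui := ((hmem i).1 hi).1
      unfold preemptiveServer
      rw [hcoe i hi, ← EReal.coe_add]
      split_ifs with hc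
      · refine iff_of_true (EReal.coe_lt_top t) ?_
        obtain ⟨j, hj1, hj2⟩ := hc
        -- Arrivals are in order, so the preempting update is a later one and is fresh as well.
        have hij : i < j := by
          by_contra hji
          rcases (not_lt.1 hji).eq_or_lt with rfl | hji
          · rw [hcoe _ hi] at hj1; exact lt_irrefl _ hj1
          · have := ha.lt j i hji (hj2.trans (EReal.coe_lt_top _)).ne
            rw [hcoe i hi] at this
            exact lt_asymm hj1 this
        by_cases hj : j ∈ I
        · rw [hcoe j hj, EReal.coe_lt_coe_iff] at hj1 hj2
          exact Or.inl ⟨j, hj, hj1, hj2⟩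
        · have : ¬ a j ≤ t := fun h => hj ((hmem j).2 ⟨hui.trans (hU hij.le), h⟩)
          exact Or.inr (EReal.coe_lt_coe_iff.1 ((not_le.1 this).trans hj2))
      · rw [EReal.coe_lt_coe_iff]
        refine ⟨Or.inr, ?_⟩
        rintro (⟨j, hj, hj1, hj2⟩ | h)
        · refine absurd ⟨j, ?_⟩ hc
          rw [hcoe j hj, EReal.coe_lt_coe_iff, EReal.coe_lt_coe_iff]
          exact ⟨hj1, hj2⟩
        · exact h
    refine ⟨fun h i hi => (key i hi).1 (h i ((hmem i).1 hi).1), fun h i hui => ?_⟩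
    by_cases hi : i ∈ I
    · exact (key i hi).2 (h i hi)
    · have hti : (t : EReal) < a i := not_le.1 fun h => hi ((hmem i).2 ⟨hui, h⟩)
      unfold preemptiveServer
      split_ifs
      · exact EReal.coe_lt_top t
      · calc (t : EReal) < a i + 0 := by simpa using hti
          _ ≤ a i + (Y i ω : EReal) := by gcongr; exact_mod_cast (hω i).le
  rw [hL, hind.measure_inter_preimage_eq_mul I fun i _ => hBm i]
  have : ∀ i ∈ I, P (Y i ⁻¹' B i) = expMeasure r (B i) := fun i _ =>
    (hY i).measure_eq (p := (· ∈ B i)) (hBm i)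
  rw [Finset.prod_congr rfl this, prod_expMeasure_survive hr b I hbmono t hbt]
  refine measure_congr ?_
  filter_upwards [ae_pos_expMeasure hr] with e he
  refine propext ?_
  change (∀ i ∈ I, t - e < b i) ↔ ∀ i, u ≤ U i → ((t - e : ℝ) : EReal) < a i
  refine ⟨fun h i hui => ?_, fun h i hi => ?_⟩
  · by_cases hi : i ∈ I
    · rw [hcoe i hi, EReal.coe_lt_coe_iff]
      exact h i hi
    · have hti : (t : EReal) < a i := not_le.1 fun h => hi ((hmem i).2 ⟨hui, h⟩)
      exact lt_of_le_of_lt (by exact_mod_cast (by linarith : t - e ≤ t)) hti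
  · have := h i ((hmem i).1 hi).1
    rwa [hcoe i hi, EReal.coe_lt_coe_iff] at this

/-! ### The Poisson source -/

/-- Functions of disjoint, possibly infinite, subfamilies of an independent family are
independent. -/
theorem indepFun_of_measurable_iSup {ι β γ : Type*} [MeasurableSpace β] [MeasurableSpace γ]
    {W : ι → Ω → ℝ} (hW : ∀ i, Measurable (W i)) (hind : iIndepFun W P) {A B : Set ι}
    (hAB : Disjoint A B) {f : Ω → β} {g : Ω → γ}
    (hf : Measurable[⨆ i ∈ A, MeasurableSpace.comap (W i) inferInstance] f)
    (hg : Measurable[⨆ i ∈ B, MeasurableSpace.comap (W i) inferInstance] g) :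
    IndepFun f g P := by
  rw [IndepFun_iff_Indep]
  exact indep_of_indep_of_le_left (indep_of_indep_of_le_right
    (indep_iSup_of_disjoint (fun i => (hW i).comap_le) hind hAB) hg.comap_le) hf.comap_le

/-- The probability of an event about two independent variables, conditioned on the first of
them. -/
theorem measure_eq_lintegral_of_indepFun [IsProbabilityMeasure P]
    {β γ : Type*} [MeasurableSpace β] [MeasurableSpace γ]
    {f : Ω → β} {g : Ω → γ} (hf : Measurable f) (hg : Measurable g) (h : IndepFun f g P)
    {C : Set (β × γ)} (hC : MeasurableSet C) :
    P {ω | (f ω, g ω) ∈ C} = ∫⁻ ω, P {ω' | (f ω, g ω') ∈ C} ∂P := by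
  have h1 := (indepFun_iff_map_prod_eq_prod_map_map hf.aemeasurable hg.aemeasurable).1 h
  have : IsProbabilityMeasure (P.map g) := Measure.isProbabilityMeasure_map hg.aemeasurable
  calc P {ω | (f ω, g ω) ∈ C} = P.map (fun ω => (f ω, g ω)) C :=
        (Measure.map_apply (hf.prodMk hg) hC).symm
    _ = ∫⁻ x, P.map g (Prod.mk x ⁻¹' C) ∂P.map f := by rw [h1, Measure.prod_apply hC]
    _ = ∫⁻ ω, P.map g (Prod.mk (f ω) ⁻¹' C) ∂P :=
        lintegral_map (measurable_measure_prodMk_left hC) hf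
    _ = _ := lintegral_congr fun ω => Measure.map_apply hg (measurable_prodMk_left hC)

theorem measurable_iSup_comap {Ω ι : Type*} {W : ι → Ω → ℝ} {A : Set ι} {i : ι} (hi : i ∈ A) :
    Measurable[⨆ i ∈ A, MeasurableSpace.comap (W i) inferInstance] (W i) :=
  Measurable.of_comap_le (le_iSup₂_of_le i hi le_rfl)

theorem submissionTime_succ (x : ℕ → ℝ) (i : ℕ) :
    submissionTime x (i + 1) = submissionTime x i + x (i + 1) :=
  Finset.sum_range_succ _ _

theorem strictMono_submissionTime {x : ℕ → ℝ} (hx : ∀ i, 0 < x i) :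
    StrictMono (submissionTime x) :=
  strictMono_nat_of_lt_succ fun i => by rw [submissionTime_succ]; linarith [hx (i + 1)]

theorem submissionTime_pos {x : ℕ → ℝ} (hx : ∀ i, 0 < x i) (i : ℕ) : 0 < submissionTime x i :=
  Finset.sum_pos (fun j _ => hx j) ⟨0, by simp⟩

theorem ae_pos_of_hasLaw {r : ℝ} (hr : 0 < r) {Y : Ω → ℝ} (hY : HasLaw Y (expMeasure r) P) :
    ∀ᵐ ω ∂P, 0 < Y ω :=
  (hY.ae_iff (p := fun x => 0 < x) measurableSet_Ioi.mem).2 (ae_pos_expMeasure hr)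

/-- The submission times tend to infinity, by the strong law of large numbers. -/
theorem ae_tendsto_submissionTime {lam : ℝ} (hlam : 0 < lam) {X : ℕ → Ω → ℝ}
    (hX : ∀ i, HasLaw (X i) (expMeasure lam) P) (hind : iIndepFun X P) :
    ∀ᵐ ω ∂P, Tendsto (submissionTime (X · ω)) atTop atTop := by
  have hint : Integrable (X 0) P := by
    have := integrable_id_expMeasure hlam
    rw [← (hX 0).map_eq] at this
    exact (integrable_map_measure (by fun_prop) (hX 0).aemeasurable).1 this
  have hE : ∫ ω, X 0 ω ∂P = 1 / lam := by
    rw [(hX 0).integral_eq, integral_id_expMeasure hlam]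
  have hid : ∀ i, IdentDistrib (X i) (X 0) P P := fun i =>
    ⟨(hX i).aemeasurable, (hX 0).aemeasurable, by rw [(hX i).map_eq, (hX 0).map_eq]⟩
  filter_upwards [strong_law_ae_real X hint (fun i j hij => hind.indepFun hij) hid] with ω hω
  rw [hE] at hω
  have h1 : Tendsto (fun n : ℕ => (∑ i ∈ Finset.range n, X i ω) / n * n) atTop atTop :=
    hω.pos_mul_atTop (by positivity) tendsto_natCast_atTop_atTop
  have h2 : Tendsto (fun n : ℕ => ∑ i ∈ Finset.range n, X i ω) atTop atTop := by
    refine h1.congr' ?_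
    filter_upwards [eventually_gt_atTop 0] with n hn
    field_simp
  exact h2.comp (tendsto_add_atTop_nat 1)

theorem measurable_submissionTime {α : Type*} {m : MeasurableSpace α} {x : α → ℕ → ℝ}
    (hx : ∀ i, Measurable fun ω => x ω i) (i : ℕ) :
    Measurable fun ω => submissionTime (x ω) i :=
  Finset.measurable_sum _ fun j _ => hx j

/-- Memorylessness of the source, on the event that update `i` is the first one submitted at time
`u` or later: given this, its submission time exceeds `u` by an exponential time. -/
theorem measure_first_fresh [IsProbabilityMeasure P] {lam : ℝ} (hlam : 0 < lam) {X : ℕ → Ω → ℝ}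
    (hXm : ∀ i, Measurable (X i))
    (hX : ∀ i, HasLaw (X i) (expMeasure lam) P) (hind : iIndepFun X P) {u t : ℝ} (hu : 0 ≤ u)
    (hut : u ≤ t) (i : ℕ) :
    P {ω | (∀ j < i, submissionTime (X · ω) j < u) ∧ t < submissionTime (X · ω) i} =
      ENNReal.ofReal (Real.exp (-(lam * (t - u)))) *
      P {ω | (∀ j < i, submissionTime (X · ω) j < u) ∧ u ≤ submissionTime (X · ω) i} := by
  -- The interarrival times before the `i`-th, padded by zeros; they are independent of `X i`.
  set f : Ω → ℕ → ℝ := fun ω j => if j < i then X j ω else 0 with hf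
  set V : (ℕ → ℝ) → ℝ := fun y => ∑ j ∈ Finset.range i, y j with hV
  have hVm : Measurable V := Finset.measurable_sum _ fun j _ => measurable_pi_apply j
  have hfm : Measurable f := by
    refine measurable_pi_lambda _ fun j => ?_
    by_cases hj : j < i <;> simp [hf, hj, hXm]
  have hfind : IndepFun f (X i) P := by
    refine indepFun_of_measurable_iSup hXm hind (A := Set.Iio i) (B := {i}) (by simp) ?_
      (measurable_iSup_comap rfl)
    refine @measurable_pi_lambda _ _ _ (_) _ _ fun j => ?_
    by_cases hj : j < i
    · simp only [hf, hj, if_true]; exact measurable_iSup_comap hj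
    · simp only [hf, hj, if_false]; exact measurable_const
  have hfU : ∀ ω, ∀ j < i, submissionTime (X · ω) j = submissionTime (f ω) j := by
    intro ω j hj
    refine Finset.sum_congr rfl fun k hk => ?_
    rw [Finset.mem_range] at hk
    simp [hf, show k < i by omega]
  have hfV : ∀ ω, submissionTime (X · ω) i = V (f ω) + X i ω := by
    intro ω
    rw [submissionTime, Finset.sum_range_succ]
    congr 1
    exact Finset.sum_congr rfl fun k hk => by simp [hf, Finset.mem_range.1 hk]
  have hD : MeasurableSet {y : ℕ → ℝ | ∀ j < i, submissionTime y j < u} := by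
    have : {y : ℕ → ℝ | ∀ j < i, submissionTime y j < u} =
        ⋂ j ∈ Set.Iio i, {y | submissionTime y j < u} := by ext; simp
    rw [this]
    exact MeasurableSet.biInter (Set.to_countable _) fun j _ =>
      measurableSet_lt (measurable_submissionTime measurable_pi_apply j) measurable_const
  have hC1 : MeasurableSet {p : (ℕ → ℝ) × ℝ | (∀ j < i, submissionTime p.1 j < u) ∧
      t < V p.1 + p.2} := (measurable_fst hD).inter
      (measurableSet_lt measurable_const ((hVm.comp measurable_fst).add measurable_snd))
  have hC2 : MeasurableSet {p : (ℕ → ℝ) × ℝ | (∀ j < i, submissionTime p.1 j < u) ∧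
      u ≤ V p.1 + p.2} := (measurable_fst hD).inter
      (measurableSet_le measurable_const ((hVm.comp measurable_fst).add measurable_snd))
  have e1 : {ω | (∀ j < i, submissionTime (X · ω) j < u) ∧ t < submissionTime (X · ω) i} =
      {ω | (f ω, X i ω) ∈ {p : (ℕ → ℝ) × ℝ | (∀ j < i, submissionTime p.1 j < u) ∧
        t < V p.1 + p.2}} := by
    ext ω
    simp +contextual only [Set.mem_ofPred_eq, hfV, hfU]
  have e2 : {ω | (∀ j < i, submissionTime (X · ω) j < u) ∧ u ≤ submissionTime (X · ω) i} =
      {ω | (f ω, X i ω) ∈ {p : (ℕ → ℝ) × ℝ | (∀ j < i, submissionTime p.1 j < u) ∧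
        u ≤ V p.1 + p.2}} := by
    ext ω
    simp +contextual only [Set.mem_ofPred_eq, hfV, hfU]
  rw [e1, e2, measure_eq_lintegral_of_indepFun hfm (hXm i) hfind hC1,
    measure_eq_lintegral_of_indepFun hfm (hXm i) hfind hC2,
    ← lintegral_const_mul' _ _ ENNReal.ofReal_ne_top]
  refine lintegral_congr fun ω => ?_
  simp only [Set.mem_ofPred_eq]
  by_cases hω : ∀ j < i, submissionTime (f ω) j < u
  · have hVu : V (f ω) ≤ u := by
      -- For `i = 0` the sum is empty, and `0 ≤ u` is what is needed.
      rcases i with _ | i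
      · simpa [hV] using hu
      · exact (hω i (Nat.lt_succ_self i)).le
    have l1 : P {ω' | t < V (f ω) + X i ω'} = expMeasure lam (Set.Ioi (t - V (f ω))) := by
      rw [← (hX i).map_eq, Measure.map_apply (hXm i) measurableSet_Ioi]
      congr 1; ext ω'; simp [sub_lt_iff_lt_add']
    have l2 : P {ω' | u ≤ V (f ω) + X i ω'} = expMeasure lam (Set.Ici (u - V (f ω))) := by
      rw [← (hX i).map_eq, Measure.map_apply (hXm i) measurableSet_Ici]
      congr 1; ext ω'; simp [add_comm]
    simp only [and_iff_right hω, l1, l2]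
    rw [expMeasure_Ioi hlam, expMeasure_Ici hlam, ← ENNReal.ofReal_mul (Real.exp_pos _).le,
      ← Real.exp_add, max_eq_left (by linarith), max_eq_left (by linarith)]
    congr 2; ring
  · simp [hω]

/-- From any instant `u ≥ 0` on, the time to the next submission is exponential. The events of
`measure_first_fresh` over all `i` are disjoint; with `u ≤` in place of `t <` they exhaust the
sample space up to a null set, so that the common factor is all that remains, and the laws of the
sums of interarrival times are not needed. -/
theorem measure_forall_fresh_lt_submissionTime [IsProbabilityMeasure P] {lam : ℝ} (hlam : 0 < lam)
    {X : ℕ → Ω → ℝ} (hXm : ∀ i, Measurable (X i))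
    (hX : ∀ i, HasLaw (X i) (expMeasure lam) P) (hind : iIndepFun X P) {u : ℝ} (hu : 0 ≤ u)
    (t : ℝ) :
    P {ω | ∀ i, u ≤ submissionTime (X · ω) i → t < submissionTime (X · ω) i} =
      expMeasure lam (Set.Ioi (t - u)) := by
  rcases lt_or_ge t u with htu | hut
  · have : {ω | ∀ i, u ≤ submissionTime (X · ω) i → t < submissionTime (X · ω) i} = Set.univ :=
      Set.eq_univ_of_forall fun ω i hi => htu.trans_le hi
    rw [this, measure_univ, expMeasure_Ioi hlam, max_eq_right (by linarith)]
    simp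
  have hUm : ∀ i, Measurable fun ω => submissionTime (X · ω) i := measurable_submissionTime hXm
  have hdisj : ∀ R : ℕ → Ω → Prop, (∀ i ω, R i ω → u ≤ submissionTime (X · ω) i) →
      Pairwise (Function.onFun Disjoint fun i =>
        {ω | (∀ j < i, submissionTime (X · ω) j < u) ∧ R i ω}) := by
    intro R hR i j hij
    refine Set.disjoint_left.2 fun ω h1 h2 => ?_
    rcases hij.lt_or_gt with h | h
    · exact (h2.1 i h).not_ge (hR i ω h1.2)
    · exact (h1.1 j h).not_ge (hR j ω h2.2)
  have hmeas : ∀ R : ℕ → Ω → Prop, (∀ i, MeasurableSet {ω | R i ω}) → ∀ i, MeasurableSet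
      {ω | (∀ j < i, submissionTime (X · ω) j < u) ∧ R i ω} := by
    intro R hR i
    refine MeasurableSet.inter ?_ (hR i)
    have : {ω | ∀ j < i, submissionTime (X · ω) j < u} =
        ⋂ j ∈ Set.Iio i, {ω | submissionTime (X · ω) j < u} := by ext; simp
    change MeasurableSet {ω | ∀ j < i, submissionTime (X · ω) j < u}
    rw [this]
    exact MeasurableSet.biInter (Set.to_countable _) fun j _ =>
      measurableSet_lt (hUm j) measurable_const
  have hpos : ∀ᵐ ω ∂P, ∀ i, 0 < X i ω := ae_all_iff.2 fun i => ae_pos_of_hasLaw hlam (hX i)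
  have htop := ae_tendsto_submissionTime hlam hX hind
  have hfind : ∀ᵐ ω ∂P, ∃ i, (∀ j < i, submissionTime (X · ω) j < u) ∧
      u ≤ submissionTime (X · ω) i := by
    classical
    filter_upwards [htop] with ω hω
    have hex : ∃ i, u ≤ submissionTime (X · ω) i := (hω.eventually_ge_atTop u).exists
    exact ⟨Nat.find hex, fun j hj => not_le.1 (Nat.find_min hex hj), Nat.find_spec hex⟩
  have hsum : ∑' i, P {ω | (∀ j < i, submissionTime (X · ω) j < u) ∧
      u ≤ submissionTime (X · ω) i} = 1 := by
    rw [← measure_iUnion (hdisj _ fun _ _ h => h)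
      (hmeas _ fun i => measurableSet_le measurable_const (hUm i)), ← measure_univ (μ := P)]
    refine measure_congr (eventuallyEq_univ.2 ?_)
    filter_upwards [hfind] with ω hω
    exact Set.mem_iUnion.2 hω
  have hE : P {ω | ∀ i, u ≤ submissionTime (X · ω) i → t < submissionTime (X · ω) i} =
      P (⋃ i, {ω | (∀ j < i, submissionTime (X · ω) j < u) ∧ t < submissionTime (X · ω) i}) := by
    refine measure_congr ?_
    filter_upwards [hpos, hfind] with ω hω hfi
    refine propext ?_
    change (∀ i, u ≤ submissionTime (X · ω) i → t < submissionTime (X · ω) i) ↔ ω ∈ ⋃ i, _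
    simp only [Set.mem_iUnion, Set.mem_ofPred_eq]
    constructor
    · intro h
      obtain ⟨i, h1, h2⟩ := hfi
      exact ⟨i, h1, h i h2⟩
    · rintro ⟨i, h1, h2⟩ j hj
      have hij : i ≤ j := not_lt.1 fun h => (h1 j h).not_ge hj
      exact h2.trans_le ((strictMono_submissionTime hω).monotone hij)
  rw [hE, measure_iUnion (hdisj _ fun _ _ h => hut.trans h.le)
      (hmeas _ fun i => measurableSet_lt measurable_const (hUm i)),
    tsum_congr fun i => measure_first_fresh hlam hXm hX hind hu hut i, ENNReal.tsum_mul_left,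
    hsum, mul_one, expMeasure_Ioi hlam, max_eq_left (by linarith)]

/-! ### The delay of fresh updates along the line -/

theorem measurable_preemptiveServer {α : Type*} {m : MeasurableSpace α} {s : α → ℕ → ℝ}
    {a : α → ℕ → EReal} (hs : ∀ i, Measurable fun x => s x i) (ha : ∀ i, Measurable fun x => a x i)
    (i : ℕ) : Measurable fun x => preemptiveServer (s x) (a x) i := by
  unfold preemptiveServer
  have hsum : Measurable fun x => a x i + (s x i : EReal) := (ha i).add (hs i).coe_real_ereal
  refine Measurable.ite ?_ measurable_const hsum
  have : {x | ∃ j, a x i < a x j ∧ a x j < a x i + (s x i : EReal)} =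
      ⋃ j, {x | a x i < a x j} ∩ {x | a x j < a x i + (s x i : EReal)} := by ext; simp
  rw [this]
  exact MeasurableSet.iUnion fun j =>
    (measurableSet_lt (ha i) (ha j)).inter (measurableSet_lt (ha j) hsum)

theorem measurableSet_forall_fresh_lt {α : Type*} {m : MeasurableSpace α} {U : α → ℕ → ℝ}
    {a : α → ℕ → EReal} {t : α → EReal} (hU : ∀ i, Measurable fun x => U x i)
    (ha : ∀ i, Measurable fun x => a x i) (ht : Measurable t) (u : ℝ) :
    MeasurableSet {x | ∀ i, u ≤ U x i → t x < a x i} := by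
  have : {x | ∀ i, u ≤ U x i → t x < a x i} = ⋂ i, {x | u ≤ U x i}ᶜ ∪ {x | t x < a x i} := by
    ext; simp [imp_iff_not_or]
  rw [this]
  exact MeasurableSet.iInter fun i => (measurableSet_le measurable_const (hU i)).compl.union
    (measurableSet_lt ht (ha i))

/-- One node of the network: if the first fresh update arrives at the server after a delay of law
`ν`, then the first fresh update departs after a delay of law `ν ∗ expMeasure r`. This averages
`measure_forall_lt_preemptiveServer` over the arrivals, which are independent of the service
times. -/
theorem measure_fresh_preemptiveServer [IsProbabilityMeasure P] {r : ℝ} (hr : 0 < r)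
    {U : Ω → ℕ → ℝ} {a : Ω → ℕ → EReal} {Y : ℕ → Ω → ℝ}
    (hUm : ∀ i, Measurable fun ω => U ω i) (ham : ∀ i, Measurable fun ω => a ω i)
    (hYm : ∀ i, Measurable (Y i)) (hY : ∀ i, HasLaw (Y i) (expMeasure r) P) (hind : iIndepFun Y P)
    (hindep : IndepFun (fun ω => (U ω, a ω)) (fun ω i => Y i ω) P)
    (hmono : ∀ᵐ ω ∂P, Monotone (U ω)) (htop : ∀ᵐ ω ∂P, Tendsto (U ω) atTop atTop)
    (hord : ∀ᵐ ω ∂P, IsInOrder (U ω) (a ω)) {ν : Measure ℝ} [SFinite ν] {u : ℝ}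
    (hν : ∀ t : ℝ, P {ω | ∀ i, u ≤ U ω i → (t : EReal) < a ω i} = ν (Set.Ioi (t - u))) (t : ℝ) :
    P {ω | ∀ i, u ≤ U ω i → (t : EReal) < preemptiveServer (Y · ω) (a ω) i} =
      Measure.conv ν (expMeasure r) (Set.Ioi (t - u)) := by
  have := isProbabilityMeasure_expMeasure hr
  set C : Set (((ℕ → ℝ) × (ℕ → EReal)) × (ℕ → ℝ)) :=
    {x | ∀ i, u ≤ x.1.1 i → (t : EReal) < preemptiveServer x.2 x.1.2 i} with hC
  have hCm : MeasurableSet C := measurableSet_forall_fresh_lt (fun i => by fun_prop)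
    (measurable_preemptiveServer (fun i => by fun_prop) fun i => by fun_prop) measurable_const u
  have hfm : Measurable fun ω => (U ω, a ω) :=
    (measurable_pi_lambda _ hUm).prodMk (measurable_pi_lambda _ ham)
  set D : Set (Ω × ℝ) := {x | ∀ i, u ≤ U x.1 i → ((t - x.2 : ℝ) : EReal) < a x.1 i} with hD
  have hDm : MeasurableSet D := measurableSet_forall_fresh_lt
    (fun i => (hUm i).comp measurable_fst) (fun i => (ham i).comp measurable_fst)
    (measurable_const.sub measurable_snd).coe_real_ereal u
  calc P {ω | ∀ i, u ≤ U ω i → (t : EReal) < preemptiveServer (Y · ω) (a ω) i}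
      = ∫⁻ ω, P {ω' | ((U ω, a ω), fun i => Y i ω') ∈ C} ∂P :=
        measure_eq_lintegral_of_indepFun hfm (measurable_pi_lambda _ hYm) hindep hCm
    _ = ∫⁻ ω, expMeasure r (Prod.mk ω ⁻¹' D) ∂P := by
        refine lintegral_congr_ae ?_
        filter_upwards [hmono, htop, hord] with ω h1 h2 h3
        exact measure_forall_lt_preemptiveServer hr hY hind h1 h2 h3 u t
    _ = ∫⁻ e, P ((fun ω => (ω, e)) ⁻¹' D) ∂expMeasure r := by
        rw [← Measure.prod_apply hDm, Measure.prod_apply_symm hDm]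
    _ = ∫⁻ e, ν (Set.Ioi (t - u - e)) ∂expMeasure r := by
        refine lintegral_congr fun e => ?_
        rw [sub_right_comm, ← hν]
        rfl
    _ = _ := (conv_Ioi _).symm

/-- The induction invariant along the line: at stage `k` updates arrive in order, their arrival
times depend only on the source and on the nodes before stage `k`, and, for every `u ≥ 0`, the
first update submitted at time `u` or later arrives after a delay of law `ν`, the same for all
`u`. The last point is stated through the event that no such update has arrived by time `t`. -/
structure IsRegularStage (P : Measure Ω) (X : ℕ → Ω → ℝ) (S : Fin n → ℕ → Ω → ℝ) (k : Fin (n + 1))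
    (ν : Measure ℝ) : Prop where
  inOrder : ∀ᵐ ω ∂P, IsInOrder (submissionTime (X · ω)) (arrivalTime (X · ω) (fun j i => S j i ω) k)
  measurable : ∀ i, Measurable[⨆ p ∈ {p : ℕ ⊕ Fin n × ℕ | ∀ q, p = Sum.inr q → q.1.castSucc < k},
      MeasurableSpace.comap (Sum.elim X (fun p : Fin n × ℕ => S p.1 p.2) p) inferInstance]
    fun ω => arrivalTime (X · ω) (fun j i => S j i ω) k i
  measure_eq : ∀ u, 0 ≤ u → ∀ t : ℝ,
    P {ω | ∀ i, u ≤ submissionTime (X · ω) i →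
      (t : EReal) < arrivalTime (X · ω) (fun j i => S j i ω) k i} = ν (Set.Ioi (t - u))

/-- The delay law at stage `k` is the convolution of the exponential laws of the source and of the
nodes before stage `k`; only its mean is recorded. -/
theorem exists_isRegularStage [IsProbabilityMeasure P] {lam : ℝ} {mu : Fin n → ℝ} (hlam : 0 < lam)
    (hmu : ∀ k, 0 < mu k) {X : ℕ → Ω → ℝ} {S : Fin n → ℕ → Ω → ℝ}
    (hN : IsLineNetwork P lam mu X S) (hXm : ∀ i, Measurable (X i))
    (hSm : ∀ k i, Measurable (S k i)) (k : Fin (n + 1)) :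
    ∃ ν, IsDelayLaw ν (1 / lam + ∑ i : Fin n with i.castSucc < k, 1 / mu i) ∧
      IsRegularStage P X S k ν := by
  set W : ℕ ⊕ Fin n × ℕ → Ω → ℝ := Sum.elim X (fun p : Fin n × ℕ => S p.1 p.2) with hW
  have hWm : ∀ p, Measurable (W p) := by
    rintro (i | p)
    · exact hXm i
    · exact hSm _ _
  have hXind : iIndepFun X P := hN.indep.precomp (g := Sum.inl) Sum.inl_injective
  have hSind : ∀ k, iIndepFun (S k) P := fun k =>
    hN.indep.precomp (g := fun i => Sum.inr (k, i)) fun i j h => by simpa using h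
  have hXpos : ∀ᵐ ω ∂P, ∀ i, 0 < X i ω :=
    ae_all_iff.2 fun i => ae_pos_of_hasLaw hlam (hN.interarrival i)
  have hUm : ∀ A : Set (ℕ ⊕ Fin n × ℕ), (∀ i, Sum.inl i ∈ A) → ∀ i,
      Measurable[⨆ p ∈ A, MeasurableSpace.comap (W p) inferInstance]
        fun ω => submissionTime (X · ω) i := fun A hA i =>
    measurable_submissionTime (m := ⨆ p ∈ A, MeasurableSpace.comap (W p) inferInstance)
      (fun i => measurable_iSup_comap (W := W) (hA i)) i
  have hle : ∀ A : Set (ℕ ⊕ Fin n × ℕ), ⨆ p ∈ A, MeasurableSpace.comap (W p) inferInstance ≤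
      (inferInstance : MeasurableSpace Ω) := fun A => iSup₂_le fun p _ => (hWm p).comap_le
  induction k using Fin.induction with
  | zero =>
    refine ⟨expMeasure lam, ?_, ?_, fun i => ?_, fun u hu t => ?_⟩
    · simpa using isDelayLaw_expMeasure hlam
    · filter_upwards [hXpos] with ω hω
      refine ⟨fun i => le_rfl, fun i j hij _ => ?_⟩
      exact EReal.coe_lt_coe_iff.2 (strictMono_submissionTime hω hij)
    · simp only [arrivalTime_zero]
      refine Measurable.coe_real_ereal (hUm _ (fun i => ?_) i)
      simp
    · simp only [arrivalTime_zero, EReal.coe_lt_coe_iff]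
      exact measure_forall_fresh_lt_submissionTime hlam hXm hN.interarrival hXind hu t
  | succ k ih =>
    obtain ⟨ν, hν, hreg⟩ := ih
    have := hν.isProbabilityMeasure
    refine ⟨Measure.conv ν (expMeasure (mu k)), ?_, ?_, fun i => ?_, fun u hu t => ?_⟩
    · have : (Finset.univ.filter fun i : Fin n => i.castSucc < k.succ) =
          insert k (Finset.univ.filter fun i : Fin n => i.castSucc < k.castSucc) := by
        ext i; simp [Fin.castSucc_lt_succ_iff, le_iff_eq_or_lt]
      rw [this, Finset.sum_insert (by simp), add_comm (1 / mu k), ← add_assoc]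
      exact hν.conv (isDelayLaw_expMeasure (hmu k))
    · have hSpos : ∀ᵐ ω ∂P, ∀ i, 0 < S k i ω :=
        ae_all_iff.2 fun i => ae_pos_of_hasLaw (hmu k) (hN.service k i)
      filter_upwards [hSpos, hreg.inOrder] with ω h1 h2
      rw [arrivalTime_succ]
      exact h2.preemptiveServer h1
    · simp only [arrivalTime_succ]
      refine measurable_preemptiveServer (m := ⨆ p ∈ _, MeasurableSpace.comap (W p) inferInstance)
        (fun i => measurable_iSup_comap (W := W) (i := Sum.inr (k, i)) ?_)
        (fun i => (hreg.measurable i).mono (biSup_mono ?_) le_rfl) i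
      · simp
      · exact fun p hp q hq => (hp q hq).trans Fin.castSucc_lt_succ
    · simp only [arrivalTime_succ]
      refine measure_fresh_preemptiveServer (hmu k)
        (fun i => (hUm Set.univ (by simp) i).mono (hle _) le_rfl)
        (fun i => (hreg.measurable i).mono (hle _) le_rfl) (hSm k) (hN.service k) (hSind k) ?_
        (hXpos.mono fun ω hω => (strictMono_submissionTime hω).monotone)
        (ae_tendsto_submissionTime hlam hN.interarrival hXind) hreg.inOrder
        (hreg.measure_eq u hu) t
      refine indepFun_of_measurable_iSup hWm hN.indep
        (A := {p | ∀ q, p = Sum.inr q → q.1.castSucc < k.castSucc})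
        (B := Set.range fun i => Sum.inr (k, i)) ?_ ?_ ?_
      · rw [Set.disjoint_left]
        rintro p hp ⟨i, rfl⟩
        exact lt_irrefl _ (hp _ rfl)
      · exact Measurable.prodMk (@measurable_pi_lambda _ _ _ (_) _ _ (hUm _ (by simp)))
          (@measurable_pi_lambda _ _ _ (_) _ _ hreg.measurable)
      · exact @measurable_pi_lambda _ _ _ (_) _ _ fun i => 
          measurable_iSup_comap (W := W) (i := Sum.inr (k, i)) (Set.mem_range_self i)

/-! ### From delays to ages -/

/-- The age exceeds `c` if and only if no update submitted at time `t - c` or later has arrived (the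
initial status counting as an update submitted at time `-a₀`). The supremum in the time stamp is
over a finite set, hence attained. -/
theorem lt_age_iff {X : ℕ → ℝ} {S : Fin n → ℕ → ℝ} {k : Fin (n + 1)}
    (htop : Tendsto (submissionTime X) atTop atTop)
    (hord : IsInOrder (submissionTime X) (arrivalTime X S k)) (a₀ c t : ℝ) :
    c < age X S a₀ k t ↔ c < t + a₀ ∧
      ∀ i, t - c ≤ submissionTime X i → (t : EReal) < arrivalTime X S k i := by
  have hfin : {u | ∃ i, arrivalTime X S k i ≤ (t : EReal) ∧ u = submissionTime X i}.Finite := by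
    obtain ⟨M, hM⟩ := (htop.eventually_gt_atTop t).exists_forall_of_atTop
    refine ((Set.finite_lt_nat M).image (submissionTime X)).subset ?_
    rintro _ ⟨i, hi, rfl⟩
    have hiM : i < M := not_le.1 fun hMi =>
      (EReal.coe_le_coe_iff.1 ((hord.le i).trans hi)).not_gt (hM i hMi)
    exact ⟨i, hiM, rfl⟩
  rw [age, lt_sub_comm, timeStamp, (hfin.insert _).csSup_lt_iff (Set.insert_nonempty _ _)]
  simp only [Set.mem_insert_iff, forall_eq_or_imp, Set.mem_ofPred_eq]
  refine and_congr ⟨fun h => by linarith, fun h => by linarith⟩ ⟨fun h i hi => ?_, ?_⟩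
  · by_contra hlt
    exact (h _ ⟨i, not_lt.1 hlt, rfl⟩).not_ge hi
  · rintro h _ ⟨i, hi, rfl⟩
    by_contra hge
    exact (h i (not_lt.1 hge)).not_ge hi

theorem measurable_age {X : ℕ → Ω → ℝ} {S : Fin n → ℕ → Ω → ℝ} {k : Fin (n + 1)}
    (hXm : ∀ i, Measurable (X i))
    (hm : ∀ i, Measurable fun ω => arrivalTime (X · ω) (fun j i => S j i ω) k i) (a₀ t : ℝ) :
    Measurable fun ω => age (X · ω) (fun j i => S j i ω) a₀ k t := by
  classical
  -- The time stamp as a supremum over a countable index type that does not depend on `ω`.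
  have h : ∀ ω, timeStamp (X · ω) (fun j i => S j i ω) a₀ k t =
      ⨆ o : Option ℕ, o.elim (-a₀) fun i =>
        if arrivalTime (X · ω) (fun j i => S j i ω) k i ≤ (t : EReal)
          then submissionTime (X · ω) i else -a₀ := by
    intro ω
    rw [timeStamp, iSup]
    congr 1
    ext u
    simp only [Set.mem_insert_iff, Set.mem_ofPred_eq, Set.mem_range]
    constructor
    · rintro (rfl | ⟨i, hi, rfl⟩)
      · exact ⟨none, rfl⟩
      · exact ⟨some i, if_pos hi⟩
    · rintro ⟨_ | i, rfl⟩
      · exact Or.inl rfl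
      · simp only [Option.elim_some]
        split_ifs with hi
        · exact Or.inr ⟨i, hi, rfl⟩
        · exact Or.inl rfl
  simp only [age, h]
  refine measurable_const.sub (Measurable.iSup fun o => ?_)
  rcases o with _ | i
  · exact measurable_const
  · exact Measurable.ite (measurableSet_le (hm i) measurable_const)
      (measurable_submissionTime hXm i) measurable_const

theorem measurable_delayToAge (a₀ t : ℝ) :
    Measurable fun y : ℝ => if y ≤ t then y else t + a₀ :=
  Measurable.ite measurableSet_Iic measurable_id measurable_const

/-- The age at time `t` is distributed as the delay of a fresh update, except that delays beyond `t`
are replaced by `t + a₀`, the age of the initial status. -/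
theorem map_age_eq [IsProbabilityMeasure P] {X : ℕ → Ω → ℝ} {S : Fin n → ℕ → Ω → ℝ}
    {k : Fin (n + 1)} {ν : Measure ℝ} [IsProbabilityMeasure ν] (hXm : ∀ i, Measurable (X i))
    (hm : ∀ i, Measurable fun ω => arrivalTime (X · ω) (fun j i => S j i ω) k i)
    (hpos : ∀ᵐ ω ∂P, ∀ i, 0 < X i ω)
    (htop : ∀ᵐ ω ∂P, Tendsto (submissionTime (X · ω)) atTop atTop)
    (hreg : IsRegularStage P X S k ν) {a₀ : ℝ} (ha₀ : 0 ≤ a₀) (t : ℝ) :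
    P.map (fun ω => age (X · ω) (fun j i => S j i ω) a₀ k t) =
      ν.map fun y => if y ≤ t then y else t + a₀ := by
  have hage := measurable_age hXm hm a₀ t
  have hf := measurable_delayToAge a₀ t
  have := Measure.isProbabilityMeasure_map (μ := P) hage.aemeasurable
  have := Measure.isProbabilityMeasure_map (μ := ν) hf.aemeasurable
  refine Measure.ext_of_Iic _ _ fun c => ?_
  rw [← Set.compl_Ioi, prob_compl_eq_one_sub measurableSet_Ioi,
    prob_compl_eq_one_sub measurableSet_Ioi, Measure.map_apply hage measurableSet_Ioi,
    Measure.map_apply hf measurableSet_Ioi]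
  congr 1
  -- For `c > t` every update is fresh, which is the same as freshness with respect to time `0`.
  have h1 : P ((fun ω => age (X · ω) (fun j i => S j i ω) a₀ k t) ⁻¹' Set.Ioi c) =
      P {ω | c < t + a₀ ∧ ∀ i, max (t - c) 0 ≤ submissionTime (X · ω) i →
        (t : EReal) < arrivalTime (X · ω) (fun j i => S j i ω) k i} := by
    refine measure_congr ?_
    filter_upwards [hpos, htop, hreg.inOrder] with ω h1 h2 h3
    refine propext ((lt_age_iff h2 h3 a₀ c t).trans ?_)
    change _ ↔ c < t + a₀ ∧ ∀ i, max (t - c) 0 ≤ submissionTime (X · ω) i →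
        (t : EReal) < arrivalTime (X · ω) (fun j i => S j i ω) k i
    simp only [max_le_iff, (submissionTime_pos h1 _).le, and_true]
  rw [h1]
  rcases le_or_gt (t + a₀) c with hc | hc
  · have e1 : (fun y : ℝ => if y ≤ t then y else t + a₀) ⁻¹' Set.Ioi c = ∅ := by
      ext y
      simp only [Set.mem_preimage, Set.mem_Ioi, Set.mem_empty_iff_false, iff_false, not_lt]
      split_ifs <;> linarith
    rw [e1]
    simp [hc.not_gt]
  · simp only [hc, true_and]
    rw [hreg.measure_eq _ (le_max_right _ _)]
    congr 1
    ext y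
    simp only [Set.mem_preimage, Set.mem_Ioi]
    rcases le_total c t with hct | hct
    · rw [max_eq_left (by linarith)]
      split_ifs <;> constructor <;> intro <;> linarith
    · rw [max_eq_right (by linarith)]
      split_ifs <;> constructor <;> intro <;> linarith

theorem hasAverageAge_of_isRegularStage [IsProbabilityMeasure P] {X : ℕ → Ω → ℝ}
    {S : Fin n → ℕ → Ω → ℝ} {k : Fin (n + 1)} {ν : Measure ℝ} {Δ : ℝ} (hν : IsDelayLaw ν Δ)
    (hXm : ∀ i, Measurable (X i))
    (hm : ∀ i, Measurable fun ω => arrivalTime (X · ω) (fun j i => S j i ω) k i)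
    (hpos : ∀ᵐ ω ∂P, ∀ i, 0 < X i ω)
    (htop : ∀ᵐ ω ∂P, Tendsto (submissionTime (X · ω)) atTop atTop)
    (hreg : IsRegularStage P X S k ν) {a₀ : ℝ} (ha₀ : 0 ≤ a₀) :
    HasAverageAge P X S a₀ k Δ := by
  have := hν.isProbabilityMeasure
  have hage := fun t => (measurable_age hXm hm a₀ t).aemeasurable (μ := P)
  have hf := fun t => (measurable_delayToAge a₀ t).aemeasurable (μ := ν)
  have hbdi : Integrable (fun y : ℝ => |y| + a₀) ν :=
    hν.integrable.abs.add (integrable_const _)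
  have hbd : ∀ t : ℝ, 0 ≤ t → ∀ᵐ y ∂ν, ‖if y ≤ t then y else t + a₀‖ ≤ |y| + a₀ := by
    intro t ht
    refine Eventually.of_forall fun y => ?_
    split_ifs with h
    · rw [Real.norm_eq_abs]; linarith
    · rw [Real.norm_eq_abs, abs_of_nonneg (by positivity)]
      linarith [le_abs_self y]
  have hmap := map_age_eq hXm hm hpos htop hreg ha₀
  refine ⟨fun t ht => ?_, ?_⟩
  · have h1 : Integrable (fun x => x) (P.map fun ω => age (X · ω) (fun j i => S j i ω) a₀ k t) := by
      rw [hmap t, integrable_map_measure (by fun_prop) (hf t)]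
      exact hbdi.mono' (hf t).aestronglyMeasurable (hbd t ht)
    exact (integrable_map_measure (by fun_prop) (hage t)).1 h1
  · have h2 : Tendsto (fun t : ℝ => ∫ y, (if y ≤ t then y else t + a₀) ∂ν) atTop (𝓝 Δ) := by
      rw [← hν.integral_eq]
      refine tendsto_integral_filter_of_dominated_convergence (fun y => |y| + a₀)
        (Eventually.of_forall fun t => (hf t).aestronglyMeasurable)
        ((eventually_ge_atTop 0).mono hbd) hbdi (Eventually.of_forall fun y => ?_)
      refine tendsto_const_nhds.congr' ?_
      filter_upwards [eventually_ge_atTop y] with t ht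
      rw [if_pos ht]
    refine h2.congr' ?_
    filter_upwards [eventually_ge_atTop 0] with t ht
    rw [← integral_map (f := fun x => x) (hf t) (by fun_prop), ← hmap t,
      integral_map (hage t) (by fun_prop)]

theorem hasAverageAge_of_measurable [IsProbabilityMeasure P] {lam : ℝ} {mu : Fin n → ℝ}
    (hlam : 0 < lam) (hmu : ∀ k, 0 < mu k) {X : ℕ → Ω → ℝ} {S : Fin n → ℕ → Ω → ℝ}
    (hN : IsLineNetwork P lam mu X S) (hXm : ∀ i, Measurable (X i))
    (hSm : ∀ k i, Measurable (S k i)) {a₀ : ℝ} (ha₀ : 0 ≤ a₀) (k : Fin (n + 1)) :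
    HasAverageAge P X S a₀ k (1 / lam + ∑ i : Fin n with i.castSucc < k, 1 / mu i) := by
  obtain ⟨ν, hν, hreg⟩ := exists_isRegularStage hlam hmu hN hXm hSm k
  refine hasAverageAge_of_isRegularStage hν hXm (fun i => (hreg.measurable i).mono ?_ le_rfl)
    (ae_all_iff.2 fun i => ae_pos_of_hasLaw hlam (hN.interarrival i))
    (ae_tendsto_submissionTime hlam hN.interarrival
      (hN.indep.precomp (g := Sum.inl) Sum.inl_injective)) hreg ha₀
  refine iSup₂_le fun p _ => Measurable.comap_le ?_
  rcases p with i | p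
  · exact hXm i
  · exact hSm _ _

/-- The average age at every stage. The random variables of a line network are only a.e. measurable,
so they are replaced by measurable versions, which leaves the age unchanged almost surely. -/
theorem IsLineNetwork.hasAverageAge [IsProbabilityMeasure P] {lam : ℝ} {mu : Fin n → ℝ}
    {X : ℕ → Ω → ℝ} {S : Fin n → ℕ → Ω → ℝ} (hN : IsLineNetwork P lam mu X S)
    (hlam : 0 < lam) (hmu : ∀ k, 0 < mu k) {a₀ : ℝ} (ha₀ : 0 ≤ a₀) (k : Fin (n + 1)) :
    HasAverageAge P X S a₀ k (1 / lam + ∑ i : Fin n with i.castSucc < k, 1 / mu i) := by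
  have hX := fun i => (hN.interarrival i).aemeasurable
  have hS := fun k i => (hN.service k i).aemeasurable
  set X' : ℕ → Ω → ℝ := fun i => (hX i).mk
  set S' : Fin n → ℕ → Ω → ℝ := fun k i => (hS k i).mk
  have hN' : IsLineNetwork P lam mu X' S' := by
    refine ⟨fun i => (hN.interarrival i).congr (hX i).ae_eq_mk.symm,
      fun k i => (hN.service k i).congr (hS k i).ae_eq_mk.symm, hN.indep.congr ?_⟩
    rintro (i | p)
    · exact (hX i).ae_eq_mk
    · exact (hS p.1 p.2).ae_eq_mk
  have hEq : ∀ t, (fun ω => age (X' · ω) (fun j i => S' j i ω) a₀ k t) =ᵐ[P]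
      fun ω => age (X · ω) (fun j i => S j i ω) a₀ k t := by
    intro t
    filter_upwards [ae_all_iff.2 fun i => (hX i).ae_eq_mk,
      ae_all_iff.2 fun k => ae_all_iff.2 fun i => (hS k i).ae_eq_mk] with ω h1 h2
    simp only [h1, h2, X', S']
  obtain ⟨h1, h2⟩ := hasAverageAge_of_measurable hlam hmu hN' (fun i => (hX i).measurable_mk)
    (fun k i => (hS k i).measurable_mk) ha₀ k
  exact ⟨fun t ht => (h1 t ht).congr (hEq t), h2.congr fun t => integral_congr_ae (hEq t)⟩

theorem IsLineNetwork.perm {lam : ℝ} {mu : Fin n → ℝ} {X : ℕ → Ω → ℝ} {S : Fin n → ℕ → Ω → ℝ}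
    (hN : IsLineNetwork P lam mu X S) (σ : Equiv.Perm (Fin n)) :
    IsLineNetwork P lam (fun k => mu (σ k)) X (fun k => S (σ k)) := by
  refine ⟨hN.interarrival, fun k => hN.service (σ k), ?_⟩
  have h := hN.indep.precomp (g := Sum.map id (Prod.map σ id))
    (Function.injective_id.sumMap (σ.injective.prodMap Function.injective_id))
  convert h using 2 with p
  rcases p with i | p <;> rfl

end LineNetwork

theorem mainTheorem1 {Ω : Type*} [MeasurableSpace Ω] (P : Measure Ω) [IsProbabilityMeasure P]
    (n : ℕ) (lam : ℝ) (mu : Fin n → ℝ) (hlam : 0 < lam) (hmu : ∀ k, 0 < mu k)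
    (X : ℕ → Ω → ℝ) (S : Fin n → ℕ → Ω → ℝ) (hN : LineNetwork.IsLineNetwork P lam mu X S)
    (a₀ : ℝ) (ha₀ : 0 ≤ a₀) :
    -- the average age at the monitor
    LineNetwork.HasAverageAge P X S a₀ (Fin.last n) (1 / lam + ∑ i, 1 / mu i) ∧
    -- the average age at the input of each node
    (∀ k : Fin n, LineNetwork.HasAverageAge P X S a₀ k.castSucc
      (1 / lam + ∑ i ∈ Finset.Iio k, 1 / mu i)) ∧
    -- reordering the servers does not change the average age at the monitor
    (∀ σ : Equiv.Perm (Fin n), LineNetwork.HasAverageAge P X (fun k => S (σ k)) a₀ (Fin.last n)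
      (1 / lam + ∑ i, 1 / mu i)) := by
  refine ⟨?_, fun k => ?_, fun σ => ?_⟩
  · simpa [Fin.castSucc_lt_last] using hN.hasAverageAge hlam hmu ha₀ (Fin.last n)
  · have h := hN.hasAverageAge hlam hmu ha₀ k.castSucc
    have e : (Finset.univ.filter fun i : Fin n => i.castSucc < k.castSucc) = Finset.Iio k := by
      ext i; simp
    rwa [e] at h
  · have h := (hN.perm σ).hasAverageAge hlam (fun k => hmu (σ k)) ha₀ (Fin.last n)
    simp only [Fin.castSucc_lt_last, Finset.filter_true] at h
    rwa [Equiv.sum_comp σ fun i => 1 / mu i] at h
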